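/- Let $A$ be an $n$-by-$n$ complex matrix, and let $\bar A$ denote its entrywise conjugate. Two matrices $A,B\in M_n(\mathbb{C})$ are unitarily congruent if $A=UBU^{T}$ for some unitary $U$. Consider blocks of the two forms $$[\sigma]\quad\text{and}\quad \tau\begin{bmatrix}0&1\\ \mu&0\end{bmatrix},\qquad \sigma,\tau\in\mathbb{R},\ \sigma\ge 0,\ \tau>0,\ \mu\in\mathbb{C},\ \mu\neq 1. \tag{$*$}$$ 1. If $\bar A A$ is normal, then $A$ is unitarily congruent to a direct sum of blocks of the form $(*)$. 2. This direct sum is uniquely determined by $A$ up to permutation of its blocks and replacement of any nonzero parameter $\mu$ by $\mu^{-1}$, where the coefficient $\tau$ of that block is at the same time replaced by $\tau|\mu|$. That is, if $A$ is unitarily congruent to a direct sum $D$ of blocks of the form $(*)$, and $D'$ is an $n$-by-$n$ direct sum of blocks of the form $(*)$, then $A$ is unitarily congruent to $D'$ if and only if $D'$ is obtained from $D$ by permuting blocks and replacing some of the pairs $(\tau,\mu)$ with $\mu\ne0$ by $(\tau|\mu|,\mu^{-1})$. 3. Conversely, if $A$ is unitarily congruent to a direct sum of blocks of the form $(*)$,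 then $\bar A A$ is normal. -/

import Mathlib

/-- `A` is congruence normal: the product of its entrywise conjugate with `A` is normal. -/
def CongruenceNormal {n : ℕ} (A : Matrix (Fin n) (Fin n) ℂ) : Prop :=
  IsStarNormal (A.map star * A)

/-- `A` is unitarily congruent to `B`: `A = U B Uᵀ` for some unitary `U`. -/
def UnitarilyCongruent {n : ℕ} (A B : Matrix (Fin n) (Fin n) ℂ) : Prop :=
  ∃ U ∈ Matrix.unitaryGroup (Fin n) ℂ, A = U * B * U.transpose

/-- Parameters of a block: `one σ` stands for the 1-by-1 block `[σ]`, and `two τ μ` for the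
2-by-2 block `τ [0 1; μ 0]`. -/
inductive CongruenceBlock : Type
  | one (σ : ℝ) : CongruenceBlock
  | two (τ : ℝ) (μ : ℂ) : CongruenceBlock

namespace CongruenceBlock

/-- The number of rows of a block. -/
def size : CongruenceBlock → ℕ
  | one _ => 1
  | two _ _ => 2

/-- The matrix of a block. -/
def toMatrix : (b : CongruenceBlock) → Matrix (Fin b.size) (Fin b.size) ℂ
  | one σ => (!![(σ : ℂ)] : Matrix (Fin 1) (Fin 1) ℂ)
  | two τ μ => ((τ : ℂ) • !![0, 1; μ, 0] : Matrix (Fin 2) (Fin 2) ℂ)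

/-- The constraints on the parameters: `σ ≥ 0`, respectively `τ > 0` and `μ ≠ 1`. -/
def IsCanonical : CongruenceBlock → Prop
  | one σ => 0 ≤ σ
  | two τ μ => 0 < τ ∧ μ ≠ 1

/-- `Equivalent b b'`: the block `b'` is `b` itself, or is obtained from the 2-by-2 block `b` by
replacing a nonzero `μ` by `μ⁻¹`, which turns the coefficient `τ` into `τ |μ|`. -/
inductive Equivalent : CongruenceBlock → CongruenceBlock → Prop
  | refl (b : CongruenceBlock) : Equivalent b b
  | inv (τ : ℝ) (μ : ℂ) (hμ : μ ≠ 0) : Equivalent (two τ μ) (two (τ * ‖μ‖) μ⁻¹)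

/-- The direct sum `b 0 ⊕ b 1 ⊕ ⋯ ⊕ b (k - 1)` of a finite sequence of blocks whose sizes add up
to `n`, as an `n`-by-`n` matrix with the blocks along the diagonal in this order. -/
def directSum {n k : ℕ} (b : Fin k → CongruenceBlock) (h : ∑ i, (b i).size = n) :
    Matrix (Fin n) (Fin n) ℂ :=
  Matrix.reindex (finSigmaFinEquiv.trans (finCongr h)) (finSigmaFinEquiv.trans (finCongr h))
    (Matrix.blockDiagonal' fun i => (b i).toMatrix)

end CongruenceBlock

/-! Write `N = A Ā`, which is normal iff `Ā A` is, and `H = Aᵀ Ā`, which is positive semidefinite.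
For unitary `U`, `Uᵀ Ū = 1`, so a congruence `A = U B Uᵀ` makes `A Ā`, `Aᵀ Ā` and `A Aᴴ` unitarily
similar to their counterparts for `B`, all through the same `U`. For a block these three matrices
are diagonal, which gives the converse at once.

Existence: Fuglede–Putnam applied to `A (Ā A) = (A Ā) A` shows that `N` and `H` commute. If `A ≠ 0`,
take a common unit eigenvector `u`, with `H u = s² u`, `s > 0` and `N u = λ u`, and set `w = s⁻¹ A
ū`. The antilinear maps `x ↦ A x̄` and `x ↦ Aᵀ x̄` both preserve the span of `u` and `w`
(`exists_reducing_pair`). If `λ ≠ s²` then `u ⊥ w` and a 2-by-2 block appears; if `λ = s²` the span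
contains a unit vector giving a 1-by-1 block. The block splits off orthogonally (`exists_split`),
and induction on the size finishes.

Uniqueness: each basis vector of a direct sum carries the triple of its three diagonal entries. A
unitary intertwining the diagonal matrices matches the triples bijectively
(`exists_equiv_of_diagonal_intertwine`). A triple determines the unordered pair of triples of its
block, and that pair determines a canonical block up to `Equivalent` (`Equivalent.of_pair_eq`);
counting blocks with a given pair yields the bijection. -/

open Matrix CongruenceBlock

/-! ### Unitary congruence and the similarities it induces -/

/-- Unitary congruence of square matrices with possibly different index types. -/
def UCong {m m' : Type*} [Fintype m] [Fintype m'] [DecidableEq m] [DecidableEq m']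
    (A : Matrix m m ℂ) (B : Matrix m' m' ℂ) : Prop :=
  ∃ U : Matrix m m' ℂ, U * Uᴴ = 1 ∧ Uᴴ * U = 1 ∧ A = U * B * Uᵀ

theorem transpose_mul_map_star_eq_one {m m' : Type*} [Fintype m] [DecidableEq m']
    {U : Matrix m m' ℂ} (h : Uᴴ * U = 1) : Uᵀ * U.map star = 1 := by
  have := congrArg Matrix.transpose h
  rwa [transpose_mul, transpose_one, conjTranspose_transpose] at this

theorem map_star_mul {m m' m'' : Type*} [Fintype m'] (A : Matrix m m' ℂ) (B : Matrix m' m'' ℂ) :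
    (A * B).map star = A.map star * B.map star := by
  ext; simp [mul_apply]

theorem card_eq_of_mul_conjTranspose_eq_one {m m' : Type*} [Fintype m] [Fintype m']
    [DecidableEq m] [DecidableEq m'] {U : Matrix m m' ℂ} (h1 : U * Uᴴ = 1) (h2 : Uᴴ * U = 1) :
    Fintype.card m = Fintype.card m' := by
  have h3 := congrArg Matrix.trace h1
  have h4 := congrArg Matrix.trace h2
  rw [Matrix.trace_mul_comm, h4, trace_one, trace_one] at h3
  exact_mod_cast h3.symm

section UCong

variable {m m' m'' : Type*} [Fintype m] [Fintype m'] [Fintype m'']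
  [DecidableEq m] [DecidableEq m'] [DecidableEq m'']

theorem UCong.refl (A : Matrix m m ℂ) : UCong A A := ⟨1, by simp, by simp, by simp⟩

theorem UCong.symm {A : Matrix m m ℂ} {B : Matrix m' m' ℂ} (h : UCong A B) : UCong B A := by
  obtain ⟨U, h1, h2, rfl⟩ := h
  refine ⟨Uᴴ, by simpa using h2, by simpa using h1, ?_⟩
  have h3 : Uᵀ * Uᴴᵀ = 1 := by rw [← transpose_mul, h2, transpose_one]
  calc B = (Uᴴ * U) * B * (Uᵀ * Uᴴᵀ) := by rw [h2, h3]; simp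
    _ = _ := by simp only [Matrix.mul_assoc]

theorem UCong.trans {A : Matrix m m ℂ} {B : Matrix m' m' ℂ} {C : Matrix m'' m'' ℂ}
    (h : UCong A B) (h' : UCong B C) : UCong A C := by
  obtain ⟨U, h1, h2, rfl⟩ := h
  obtain ⟨V, h3, h4, rfl⟩ := h'
  refine ⟨U * V, ?_, ?_, ?_⟩
  · calc U * V * (U * V)ᴴ = U * (V * Vᴴ) * Uᴴ := by simp only [conjTranspose_mul, Matrix.mul_assoc]
      _ = 1 := by rw [h3, Matrix.mul_one, h1]
  · calc (U * V)ᴴ * (U * V) = Vᴴ * (Uᴴ * U) * V := by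
          simp only [conjTranspose_mul, Matrix.mul_assoc]
      _ = 1 := by rw [h2, Matrix.mul_one, h4]
  · simp only [transpose_mul, Matrix.mul_assoc]

theorem UCong.submatrix (A : Matrix m m ℂ) (e : m' ≃ m) : UCong A (A.submatrix e e) := by
  refine ⟨(1 : Matrix m m ℂ).submatrix id e, ?_, ?_, ?_⟩
  · rw [conjTranspose_submatrix, submatrix_mul_equiv]; simp
  · rw [conjTranspose_submatrix, ← submatrix_mul _ _ _ _ _ Function.bijective_id]; simp
  · rw [transpose_submatrix, submatrix_mul_equiv, submatrix_mul_equiv]; simp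

theorem UCong.card_eq {A : Matrix m m ℂ} {B : Matrix m' m' ℂ} (h : UCong A B) :
    Fintype.card m = Fintype.card m' := by
  obtain ⟨U, h1, h2, -⟩ := h
  exact card_eq_of_mul_conjTranspose_eq_one h1 h2

theorem UCong.fromBlocks {p q p' q' : Type*} [Fintype p] [Fintype q] [Fintype p'] [Fintype q']
    [DecidableEq p] [DecidableEq q] [DecidableEq p'] [DecidableEq q']
    {A : Matrix p p ℂ} {B : Matrix q q ℂ} {A' : Matrix p' p' ℂ} {B' : Matrix q' q' ℂ}
    (hA : UCong A A') (hB : UCong B B') :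
    UCong (fromBlocks A 0 0 B) (fromBlocks A' 0 0 B') := by
  obtain ⟨U, h1, h2, rfl⟩ := hA
  obtain ⟨V, h3, h4, rfl⟩ := hB
  refine ⟨Matrix.fromBlocks U 0 0 V, ?_, ?_, ?_⟩ <;>
    simp [fromBlocks_conjTranspose, fromBlocks_transpose, fromBlocks_multiply, *]

theorem UCong.blockDiagonal {ι ι' : Type*} [Fintype ι] [Fintype ι'] [DecidableEq ι]
    [DecidableEq ι'] {s : ι → Type*} {s' : ι' → Type*} [∀ i, Fintype (s i)]
    [∀ i, Fintype (s' i)] [∀ i, DecidableEq (s i)] [∀ i, DecidableEq (s' i)]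
    {M : ∀ i, Matrix (s i) (s i) ℂ} {M' : ∀ i, Matrix (s' i) (s' i) ℂ} (e : ι ≃ ι')
    (h : ∀ i, UCong (M i) (M' (e i))) :
    UCong (blockDiagonal' M) (blockDiagonal' M') := by
  have h1 : UCong (blockDiagonal' M) (blockDiagonal' fun i => M' (e i)) := by
    choose U h1 h2 h3 using h
    refine ⟨blockDiagonal' U, ?_, ?_, ?_⟩
    · rw [blockDiagonal'_conjTranspose, ← blockDiagonal'_mul]
      simp only [h1]; exact blockDiagonal'_one
    · rw [blockDiagonal'_conjTranspose, ← blockDiagonal'_mul]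
      simp only [h2]; exact blockDiagonal'_one
    · rw [blockDiagonal'_transpose, ← blockDiagonal'_mul, ← blockDiagonal'_mul]
      simp only [← h3]
  have h2 := UCong.submatrix (blockDiagonal' M') (e.sigmaCongrLeft (β := s'))
  have h3 : (blockDiagonal' M').submatrix (e.sigmaCongrLeft (β := s')) (e.sigmaCongrLeft (β := s'))
      = blockDiagonal' fun i => M' (e i) := by
    ext ⟨i, x⟩ ⟨j, y⟩
    by_cases hij : i = j
    · subst hij
      simp [Equiv.sigmaCongrLeft]
    · simp [Equiv.sigmaCongrLeft, blockDiagonal'_apply_ne, hij]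
  rw [h3] at h2
  exact h1.trans h2.symm

/-- The inner factor `Uᵀ Ū` cancels, so these products change by similarity, with one and the same
`U`. -/
theorem mul_map_star_of_eq {m m' : Type*} [Fintype m] [Fintype m'] [DecidableEq m']
    {A : Matrix m m ℂ} {B : Matrix m' m' ℂ} {U : Matrix m m' ℂ}
    (h : Uᴴ * U = 1) (hA : A = U * B * Uᵀ) :
    A * A.map star = U * (B * B.map star) * Uᴴ ∧ Aᵀ * A.map star = U * (Bᵀ * B.map star) * Uᴴ ∧
      A * Aᴴ = U * (B * Bᴴ) * Uᴴ := by
  have key : ∀ X Y : Matrix m' m' ℂ,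
      U * X * Uᵀ * (U.map star * Y * Uᴴ) = U * (X * Y) * Uᴴ := by
    intro X Y
    calc _ = U * X * (Uᵀ * U.map star) * Y * Uᴴ := by simp only [Matrix.mul_assoc]
      _ = _ := by
        rw [transpose_mul_map_star_eq_one h]; simp only [Matrix.mul_assoc, Matrix.mul_one]
  have h1 : Uᵀ.map star = Uᴴ := rfl
  have h2 : Uᵀᴴ = U.map star := rfl
  subst hA
  refine ⟨?_, ?_, ?_⟩ <;> rw [← key]
  · rw [map_star_mul, map_star_mul, h1]
  · rw [map_star_mul, map_star_mul, h1, transpose_mul, transpose_mul, transpose_transpose,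
      ← Matrix.mul_assoc U]
  · rw [conjTranspose_mul, conjTranspose_mul, h2, Matrix.mul_assoc (U.map star)]

theorem UCong.isStarNormal {A : Matrix m m ℂ} {B : Matrix m' m' ℂ} (h : UCong A B)
    (hA : IsStarNormal (A * A.map star)) : IsStarNormal (B * B.map star) := by
  obtain ⟨V, h1, h2, hB⟩ := h.symm
  rw [(mul_map_star_of_eq h2 hB).1]
  have h3 : ∀ X Y : Matrix m m ℂ, V * X * Vᴴ * (V * Y * Vᴴ) = V * (X * Y) * Vᴴ := by
    intro X Y
    calc _ = V * X * (Vᴴ * V) * Y * Vᴴ := by simp only [Matrix.mul_assoc]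
      _ = _ := by rw [h2]; simp only [Matrix.mul_assoc, Matrix.mul_one]
  refine ⟨?_⟩
  have h4 : star (V * (A * A.map star) * Vᴴ) = V * star (A * A.map star) * Vᴴ := by
    simp only [star_eq_conjTranspose, conjTranspose_mul, conjTranspose_conjTranspose,
      Matrix.mul_assoc]
  rw [h4, commute_iff_eq, h3, h3, hA.star_comm_self.eq]

end UCong

/-- Entrywise conjugation preserves products and adjoints, and exchanges `Ā A` with `A Ā`. -/
theorem congruenceNormal_iff {n : ℕ} (A : Matrix (Fin n) (Fin n) ℂ) :
    CongruenceNormal A ↔ IsStarNormal (A * A.map star) := by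
  have key : ∀ B : Matrix (Fin n) (Fin n) ℂ, IsStarNormal B → IsStarNormal (B.map star) := by
    intro B hB
    refine ⟨?_⟩
    have h := congrArg (fun M : Matrix (Fin n) (Fin n) ℂ => M.map star) hB.star_comm_self.eq
    simp only [map_star_mul] at h
    exact h
  have h1 : (A.map star).map star = A := by ext; simp
  constructor
  · intro h
    have := key _ h
    rwa [map_star_mul, h1] at this
  · intro h
    have := key _ h
    rwa [map_star_mul, h1] at this

theorem unitarilyCongruent_iff {n : ℕ} (A B : Matrix (Fin n) (Fin n) ℂ) :
    UnitarilyCongruent A B ↔ UCong A B := by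
  constructor
  · rintro ⟨U, hU, h⟩
    exact ⟨U, mem_unitaryGroup_iff.1 hU, mem_unitaryGroup_iff'.1 hU, h⟩
  · rintro ⟨U, h1, h2, h⟩
    exact ⟨U, mem_unitaryGroup_iff.2 h1, h⟩

theorem uCong_directSum {n k : ℕ} (b : Fin k → CongruenceBlock) (h : ∑ i, (b i).size = n) :
    UCong (CongruenceBlock.directSum b h) (blockDiagonal' fun i => (b i).toMatrix) :=
  (UCong.submatrix (blockDiagonal' fun i => (b i).toMatrix)
    (finSigmaFinEquiv.trans (finCongr h)).symm).symm

/-! ### Invariants of a single block -/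

namespace CongruenceBlock

/-- The conjugate eigenvalues of `b.toMatrix * conj b.toMatrix`, and the squared lengths of the
columns and rows of `b.toMatrix`. -/
noncomputable def triple : (b : CongruenceBlock) → Fin b.size → ℂ × ℂ × ℂ
  | one σ => fun _ => ((σ : ℂ) ^ 2, (σ : ℂ) ^ 2, (σ : ℂ) ^ 2)
  | two τ μ => (![((τ : ℂ) ^ 2 * star μ, (τ : ℂ) ^ 2 * (μ * star μ), (τ : ℂ) ^ 2),
      ((τ : ℂ) ^ 2 * μ, (τ : ℂ) ^ 2, (τ : ℂ) ^ 2 * (μ * star μ))] : Fin 2 → ℂ × ℂ × ℂ)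

/-- The triple of the other basis vector of the same block. -/
def swapTriple (t : ℂ × ℂ × ℂ) : ℂ × ℂ × ℂ := (star t.1, t.2.2, t.2.1)

/-- The unordered pair of triples of a block. -/
noncomputable def pair : CongruenceBlock → Sym2 (ℂ × ℂ × ℂ)
  | one σ => s(triple (one σ) (0 : Fin 1), triple (one σ) (0 : Fin 1))
  | two τ μ => s(triple (two τ μ) (0 : Fin 2), triple (two τ μ) (1 : Fin 2))

/-- One triple recovers the whole pair, so a matching of basis vectors also matches the pairs of
their blocks. -/
theorem pair_eq (b : CongruenceBlock) (j : Fin b.size) :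
    b.pair = s(b.triple j, swapTriple (b.triple j)) := by
  cases b with
  | one σ => simp [pair, triple, swapTriple]
  | two τ μ =>
    change Fin 2 at j
    fin_cases j
    · simp [pair, triple, swapTriple]
    · rw [Sym2.eq_swap]; simp [pair, triple, swapTriple]

theorem size_pos (b : CongruenceBlock) : 0 < b.size := by cases b <;> simp [size]

theorem Equivalent.size_eq {b c : CongruenceBlock} (h : Equivalent b c) : b.size = c.size := by
  cases h <;> rfl

theorem sq_norm_eq_mul_star (μ : ℂ) : (‖μ‖ : ℂ) ^ 2 = μ * star μ := by
  simpa using (Complex.mul_conj' μ).symm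

theorem Equivalent.pair_eq {b c : CongruenceBlock} (h : Equivalent b c) : b.pair = c.pair := by
  cases h with
  | refl => rfl
  | inv τ μ hμ =>
    have h2 : star μ ≠ 0 := by simpa using hμ
    simp only [pair, triple, Sym2.eq_iff]
    right
    simp only [Complex.ofReal_mul, mul_pow, sq_norm_eq_mul_star, star_inv₀, Matrix.cons_val_zero,
      Matrix.cons_val_one, Prod.mk.injEq]
    refine ⟨⟨?_, ?_, ?_⟩, ?_, ?_, ?_⟩ <;> first | trivial | field_simp

theorem toMatrix_diagonal (b : CongruenceBlock) :
    b.toMatrix * b.toMatrix.map star = diagonal (fun j => (b.triple j).1) ∧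
    b.toMatrixᵀ * b.toMatrix.map star = diagonal (fun j => (b.triple j).2.1) ∧
    b.toMatrix * b.toMatrixᴴ = diagonal (fun j => (b.triple j).2.2) := by
  cases b with
  | one σ =>
    suffices h : ∀ M : Matrix (Fin 1) (Fin 1) ℂ, M = !![(σ : ℂ)] →
        M * M.map star = diagonal (fun _ => (σ : ℂ) ^ 2) ∧
        Mᵀ * M.map star = diagonal (fun _ => (σ : ℂ) ^ 2) ∧
        M * Mᴴ = diagonal (fun _ => (σ : ℂ) ^ 2) from h _ rfl
    rintro _ rfl
    refine ⟨?_, ?_, ?_⟩ <;>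
    · ext i j
      rw [Subsingleton.elim i 0, Subsingleton.elim j 0]
      simp [mul_apply, sq]
  | two τ μ =>
    suffices h : ∀ M : Matrix (Fin 2) (Fin 2) ℂ, M = (τ : ℂ) • !![0, 1; μ, 0] →
        M * M.map star = diagonal (fun j : Fin 2 => ((two τ μ).triple j).1) ∧
        Mᵀ * M.map star = diagonal (fun j : Fin 2 => ((two τ μ).triple j).2.1) ∧
        M * Mᴴ = diagonal (fun j : Fin 2 => ((two τ μ).triple j).2.2) from h _ rfl
    rintro _ rfl
    refine ⟨?_, ?_, ?_⟩ <;>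
    · ext i j
      fin_cases i <;> fin_cases j <;> simp [triple, mul_apply] <;> ring

theorem Equivalent.of_pair_eq {b c : CongruenceBlock} (hb : b.IsCanonical) (hc : c.IsCanonical)
    (h : b.pair = c.pair) : Equivalent b c := by
  -- The entries of a 1-by-1 block's triple coincide, which would force `μ = 1`: this is where that
  -- exclusion is needed.
  have key : ∀ (σ τ : ℝ) (μ : ℂ), 0 < τ → μ ≠ 1 → (one σ).pair ≠ (two τ μ).pair := by
    intro σ τ μ hτ hμ h
    have hτ' : (τ : ℂ) ^ 2 ≠ 0 := by simpa using hτ.ne'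
    simp only [pair, triple, Sym2.eq_iff, Matrix.cons_val_zero, Matrix.cons_val_one,
      Prod.mk.injEq] at h
    apply hμ
    have h1 : (τ : ℂ) ^ 2 * μ = (τ : ℂ) ^ 2 * 1 := by
      rcases h with ⟨⟨-, -, h2⟩, ⟨h3, -, -⟩⟩ | ⟨⟨h2, -, -⟩, ⟨-, -, h3⟩⟩
      · rw [← h3, h2, mul_one]
      · rw [← h2, h3, mul_one]
    exact mul_left_cancel₀ hτ' h1
  cases b with
  | one σ =>
    cases c with
    | one σ' =>
      have h1 : (σ : ℂ) ^ 2 = (σ' : ℂ) ^ 2 := by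
        simpa [pair, triple] using h
      have h2 : σ = σ' := by
        have : σ ^ 2 = σ' ^ 2 := by exact_mod_cast h1
        exact (sq_eq_sq₀ hb hc).1 this
      rw [h2]
      exact .refl _
    | two τ μ => exact absurd h (key _ _ _ hc.1 hc.2)
  | two τ μ =>
    cases c with
    | one σ => exact absurd h.symm (key _ _ _ hb.1 hb.2)
    | two τ' μ' =>
      obtain ⟨hτ, -⟩ := hb
      obtain ⟨hτ', -⟩ := hc
      have h0 : (τ : ℂ) ^ 2 ≠ 0 := by simpa using hτ.ne'
      have h0' : (τ' : ℂ) ^ 2 ≠ 0 := by simpa using hτ'.ne'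
      simp only [pair, triple, Sym2.eq_iff, Matrix.cons_val_zero, Matrix.cons_val_one,
        Prod.mk.injEq] at h
      rcases h with ⟨⟨-, -, h1⟩, ⟨h2, -, -⟩⟩ | ⟨⟨h1, -, h2⟩, ⟨-, -, h3⟩⟩
      · rw [← h1] at h2
        have h3 : τ ^ 2 = τ' ^ 2 := by exact_mod_cast h1
        rw [mul_left_cancel₀ h0 h2, (sq_eq_sq₀ hτ.le hτ'.le).1 h3]
        exact .refl _
      -- The crosswise matching of triples is the replacement of `μ` by `μ⁻¹`.
      · have hμ : μ ≠ 0 := by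
          rintro rfl
          exact h0' (by simpa using h3.symm)
        have h4 : τ' = τ * ‖μ‖ := by
          rw [← sq_norm_eq_mul_star] at h3
          have : τ ^ 2 * ‖μ‖ ^ 2 = τ' ^ 2 := by exact_mod_cast h3
          rw [← mul_pow] at this
          exact ((sq_eq_sq₀ (by positivity) hτ'.le).1 this).symm
        have h5 : μ' = μ⁻¹ := by
          rw [← h3] at h1
          have h6 : star μ ≠ 0 := by simpa using hμ
          have h7 : (τ ^ 2 * star μ) * 1 = (τ ^ 2 * star μ) * (μ * μ') := by
            linear_combination h1
          exact eq_inv_of_mul_eq_one_right (mul_left_cancel₀ (mul_ne_zero h0 h6) h7).symm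
        rw [h4, h5]
        exact .inv _ _ hμ

theorem Equivalent.uCong {b c : CongruenceBlock} (h : Equivalent b c) :
    UCong b.toMatrix c.toMatrix := by
  cases h with
  | refl => exact UCong.refl _
  | inv τ μ hμ =>
    have h2 : star μ ≠ 0 := by simpa using hμ
    have h3 : (‖μ‖ : ℂ) ≠ 0 := by simpa using hμ
    have h1 := sq_norm_eq_mul_star μ
    have h1' : star μ = (‖μ‖ : ℂ) ^ 2 / μ := by rw [h1]; field_simp
    simp only [Complex.star_def] at h1'
    suffices h : ∃ U : Matrix (Fin 2) (Fin 2) ℂ, U * Uᴴ = 1 ∧ Uᴴ * U = 1 ∧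
        (τ : ℂ) • !![0, 1; μ, 0] =
          U * (((τ * ‖μ‖ : ℝ) : ℂ) • !![0, 1; μ⁻¹, 0]) * Uᵀ from h
    -- Exchange the two basis vectors; the phase of `μ` restores the argument lost in `‖μ‖`.
    refine ⟨!![0, 1; μ / ‖μ‖, 0], ?_, ?_, ?_⟩
    · ext i j
      fin_cases i <;> fin_cases j <;> simp [mul_apply, h1']; field_simp
    · ext i j
      fin_cases i <;> fin_cases j <;> simp [mul_apply, h1']; field_simp
    · ext i j
      fin_cases i <;> fin_cases j <;> simp [mul_apply] <;> field_simp

end CongruenceBlock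

/-! ### Uniqueness of the direct sum -/

/-- Since `det U ≠ 0`, some term of the Leibniz expansion is nonzero, and its permutation runs
through nonzero entries of `U` only. -/
theorem exists_equiv_of_diagonal_intertwine {m m' T : Type*} [Fintype m] [Fintype m']
    [DecidableEq m] [DecidableEq m'] {U : Matrix m m' ℂ} (h1 : U * Uᴴ = 1) (h2 : Uᴴ * U = 1)
    {d : m → T} {d' : m' → T} (h : ∀ i j, U i j ≠ 0 → d i = d' j) :
    ∃ e : m ≃ m', ∀ i, d i = d' (e i) := by
  let f : m ≃ m' := Fintype.equivOfCardEq (card_eq_of_mul_conjTranspose_eq_one h1 h2)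
  have hdet : (U.submatrix id f).det ≠ 0 := by
    apply det_ne_zero_of_right_inverse (B := Uᴴ.submatrix f id)
    rw [submatrix_mul_equiv, h1, submatrix_id_id]
  rw [det_apply] at hdet
  obtain ⟨σ, -, hσ⟩ := Finset.exists_ne_zero_of_sum_ne_zero hdet
  have h3 : ∀ i, U (σ i) (f i) ≠ 0 := by
    intro i hi
    apply hσ
    rw [Finset.prod_eq_zero (Finset.mem_univ i) (by simpa using hi), smul_zero]
  refine ⟨σ.symm.trans f, fun i => ?_⟩
  have := h _ _ (h3 (σ.symm i))
  simpa using this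

section

variable {ι ι' : Type} [Fintype ι] [Fintype ι'] [DecidableEq ι] [DecidableEq ι']

theorem blockDiagonal_toMatrix_diagonal (b : ι → CongruenceBlock) :
    let D := blockDiagonal' fun i => (b i).toMatrix
    D * D.map star = diagonal (fun x => ((b x.1).triple x.2).1) ∧
    Dᵀ * D.map star = diagonal (fun x => ((b x.1).triple x.2).2.1) ∧
    D * Dᴴ = diagonal (fun x => ((b x.1).triple x.2).2.2) := by
  intro D
  have h : D.map star = blockDiagonal' fun i => (b i).toMatrix.map star :=
    blockDiagonal'_map _ _ (star_zero _)
  rw [h, blockDiagonal'_transpose, blockDiagonal'_conjTranspose]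
  simp only [D, ← blockDiagonal'_mul, (toMatrix_diagonal _).1, (toMatrix_diagonal _).2.1,
    (toMatrix_diagonal _).2.2, blockDiagonal'_diagonal, and_self]

theorem isStarNormal_blockDiagonal_toMatrix (b : ι → CongruenceBlock) :
    IsStarNormal ((blockDiagonal' fun i => (b i).toMatrix) *
      (blockDiagonal' fun i => (b i).toMatrix).map star) := by
  rw [(blockDiagonal_toMatrix_diagonal b).1]
  refine ⟨?_⟩
  rw [star_eq_conjTranspose, diagonal_conjTranspose, commute_iff_eq, diagonal_mul_diagonal,
    diagonal_mul_diagonal]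
  simp only [mul_comm]

theorem exists_equiv_triple {b : ι → CongruenceBlock} {b' : ι' → CongruenceBlock}
    (h : UCong (blockDiagonal' fun i => (b i).toMatrix) (blockDiagonal' fun i => (b' i).toMatrix)) :
    ∃ e : (Σ i, Fin (b i).size) ≃ (Σ i, Fin (b' i).size),
      ∀ x, (b x.1).triple x.2 = (b' (e x).1).triple (e x).2 := by
  obtain ⟨U, h1, h2, hU⟩ := h
  obtain ⟨e1, e2, e3⟩ := mul_map_star_of_eq h2 hU
  obtain ⟨f1, f2, f3⟩ := blockDiagonal_toMatrix_diagonal b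
  obtain ⟨g1, g2, g3⟩ := blockDiagonal_toMatrix_diagonal b'
  rw [f1, g1] at e1
  rw [f2, g2] at e2
  rw [f3, g3] at e3
  have key : ∀ (d : (Σ i, Fin (b i).size) → ℂ) (d' : (Σ i, Fin (b' i).size) → ℂ),
      diagonal d = U * diagonal d' * Uᴴ → ∀ i j, U i j ≠ 0 → d i = d' j := by
    intro d d' hd i j hij
    have h3 : diagonal d * U = U * diagonal d' := by
      rw [hd, Matrix.mul_assoc, h2, Matrix.mul_one]
    have h4 := congrFun (congrFun h3 i) j
    rw [diagonal_mul, mul_diagonal, mul_comm] at h4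
    exact mul_left_cancel₀ hij h4
  exact exists_equiv_of_diagonal_intertwine h1 h2 fun i j hij =>
    Prod.ext (key _ _ e1 i j hij) (Prod.ext (key _ _ e2 i j hij) (key _ _ e3 i j hij))

theorem exists_equiv_equivalent {b : ι → CongruenceBlock} {b' : ι' → CongruenceBlock}
    (hb : ∀ i, (b i).IsCanonical) (hb' : ∀ i, (b' i).IsCanonical)
    (h : UCong (blockDiagonal' fun i => (b i).toMatrix) (blockDiagonal' fun i => (b' i).toMatrix)) :
    ∃ e : ι ≃ ι', ∀ i, Equivalent (b i) (b' (e i)) := by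
  classical
  obtain ⟨p, hp⟩ := exists_equiv_triple h
  have hp' : ∀ x, (b x.1).pair = (b' (p x).1).pair := fun x => by
    rw [pair_eq _ x.2, pair_eq _ (p x).2, hp]
  -- Both sides count the basis vectors lying in blocks with pair `v`.
  have hsum : ∀ v, ∑ i with (b i).pair = v, (b i).size = ∑ i with (b' i).pair = v, (b' i).size := by
    intro v
    have h1 : ∀ {κ : Type} [Fintype κ] (c : κ → CongruenceBlock),
        ∑ i with (c i).pair = v, (c i).size =
          Fintype.card {x : Σ i, Fin (c i).size // (c x.1).pair = v} := by
      intro κ _ c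
      rw [Fintype.card_subtype, Finset.card_filter, Fintype.sum_sigma, Finset.sum_filter]
      refine Finset.sum_congr rfl fun i _ => ?_
      by_cases hi : (c i).pair = v <;> simp [hi]
    rw [h1, h1]
    exact Fintype.card_congr (p.subtypeEquiv fun x => by rw [hp'])
  have hcard : ∀ v, Fintype.card {i // (b i).pair = v} = Fintype.card {i // (b' i).pair = v} := by
    intro v
    -- Blocks with the same pair are equivalent, hence of a common size `s`, by which the count of
    -- basis vectors can be divided. Any block with pair `v` supplies such an `s`, so without one
    -- both fibres are empty.
    by_cases hv : ∃ s : ℕ, 0 < s ∧ (∀ i, (b i).pair = v → (b i).size = s) ∧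
        (∀ i, (b' i).pair = v → (b' i).size = s)
    · obtain ⟨s, hs, h1, h2⟩ := hv
      have := hsum v
      rw [Finset.sum_const_nat (m := s) (by simpa using h1),
        Finset.sum_const_nat (m := s) (by simpa using h2)] at this
      rw [Fintype.card_subtype, Fintype.card_subtype]
      exact Nat.eq_of_mul_eq_mul_right hs this
    · have hb0 : ∀ i, (b i).pair ≠ v := fun i hi => hv ⟨(b i).size, size_pos _,
        fun j hj => (Equivalent.of_pair_eq (hb j) (hb i) (hj.trans hi.symm)).size_eq,
        fun j hj => (Equivalent.of_pair_eq (hb' j) (hb i) (hj.trans hi.symm)).size_eq⟩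
      have hb0' : ∀ i, (b' i).pair ≠ v := fun i hi => hv ⟨(b' i).size, size_pos _,
        fun j hj => (Equivalent.of_pair_eq (hb j) (hb' i) (hj.trans hi.symm)).size_eq,
        fun j hj => (Equivalent.of_pair_eq (hb' j) (hb' i) (hj.trans hi.symm)).size_eq⟩
      simp [hb0, hb0']
  let E := Equiv.ofFiberEquiv (f := fun i => (b i).pair) (g := fun i => (b' i).pair)
    fun v => Fintype.equivOfCardEq (hcard v)
  have hE : ∀ i, (b' (E i)).pair = (b i).pair := fun i =>
    Equiv.ofFiberEquiv_map (f := fun i => (b i).pair) (g := fun i => (b' i).pair) _ i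
  exact ⟨E, fun i => Equivalent.of_pair_eq (hb _) (hb' _) (hE i).symm⟩

end

/-! ### Vectors that span a reducing block -/

section

variable {m : Type*} [Fintype m]

theorem exists_normalize {x : m → ℂ} (hx : x ≠ 0) :
    ∃ c : ℝ, star ((c : ℂ) • x) ⬝ᵥ ((c : ℂ) • x) = 1 := by
  have h1 : star x ⬝ᵥ x = ((∑ i, ‖x i‖ ^ 2 : ℝ) : ℂ) := by
    simp [dotProduct, Complex.conj_mul']
  have h2 : 0 < ∑ i, ‖x i‖ ^ 2 := by
    obtain ⟨i, hi⟩ := Function.ne_iff.1 hx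
    exact Finset.sum_pos' (fun i _ => by positivity) ⟨i, Finset.mem_univ _, by
      have : 0 < ‖x i‖ := norm_pos_iff.2 hi
      positivity⟩
  refine ⟨(Real.sqrt (∑ i, ‖x i‖ ^ 2))⁻¹, ?_⟩
  rw [star_smul, smul_dotProduct, dotProduct_smul, h1]
  simp only [Complex.star_def, Complex.conj_ofReal, smul_eq_mul, ← Complex.ofReal_mul]
  rw [← mul_assoc, ← mul_inv, Real.mul_self_sqrt h2.le, inv_mul_cancel₀ h2.ne']
  simp

theorem exists_one_of_vec {A : Matrix m m ℂ} {σ : ℝ} (hσ : 0 ≤ σ) {v : m → ℂ}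
    (hv : star v ⬝ᵥ v = 1) (h1 : A *ᵥ star v = (σ : ℂ) • v) (h2 : Aᵀ *ᵥ star v = (σ : ℂ) • v) :
    ∃ (c : CongruenceBlock) (V : Matrix m (Fin c.size) ℂ), c.IsCanonical ∧ Vᴴ * V = 1 ∧
      A * V.map star = V * c.toMatrix ∧ Aᵀ * V.map star = V * c.toMatrixᵀ := by
  suffices h : ∃ V : Matrix m (Fin 1) ℂ, Vᴴ * V = 1 ∧
      A * V.map star = V * !![(σ : ℂ)] ∧ Aᵀ * V.map star = V * (!![(σ : ℂ)])ᵀ by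
    obtain ⟨V, hV⟩ := h
    exact ⟨one σ, V, hσ, hV⟩
  refine ⟨of fun i _ => v i, ?_, ?_, ?_⟩ <;> ext i j
  · rw [Subsingleton.elim i j, one_apply_eq]
    exact hv
  · rw [Subsingleton.elim j 0]
    have := congrFun h1 i
    simp only [mulVec, dotProduct, Pi.star_apply, Pi.smul_apply, smul_eq_mul] at this
    simp [mul_apply, mul_comm (v i), ← this]
  · rw [Subsingleton.elim j 0]
    have := congrFun h2 i
    simp only [mulVec, dotProduct, Pi.star_apply, Pi.smul_apply, smul_eq_mul] at this
    simp [mul_apply, mul_comm (v i), ← this]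

theorem exists_two_of_vec {A : Matrix m m ℂ} {s : ℝ} (hs : 0 < s) {lam : ℂ}
    (hlam : lam ≠ (s : ℂ) ^ 2) {u w : m → ℂ} (hu : star u ⬝ᵥ u = 1) (hw : star w ⬝ᵥ w = 1)
    (huw : star u ⬝ᵥ w = 0) (h1 : A *ᵥ star u = (s : ℂ) • w) (h2 : A *ᵥ star w = (lam / s) • u)
    (h3 : Aᵀ *ᵥ star u = (lam / s) • w) (h4 : Aᵀ *ᵥ star w = (s : ℂ) • u) :
    ∃ (c : CongruenceBlock) (V : Matrix m (Fin c.size) ℂ), c.IsCanonical ∧ Vᴴ * V = 1 ∧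
      A * V.map star = V * c.toMatrix ∧ Aᵀ * V.map star = V * c.toMatrixᵀ := by
  have hs' : (s : ℂ) ≠ 0 := by simpa using hs.ne'
  suffices h : ∃ V : Matrix m (Fin 2) ℂ, Vᴴ * V = 1 ∧
      A * V.map star = V * ((s : ℂ) • !![0, 1; lam / (s : ℂ) ^ 2, 0]) ∧
      Aᵀ * V.map star = V * ((s : ℂ) • !![0, 1; lam / (s : ℂ) ^ 2, 0])ᵀ by
    obtain ⟨V, hV⟩ := h
    refine ⟨two s (lam / (s : ℂ) ^ 2), V, ⟨hs, fun h => hlam ?_⟩, hV⟩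
    rwa [div_eq_one_iff_eq (pow_ne_zero 2 hs')] at h
  have hwu : star w ⬝ᵥ u = 0 := by
    rw [star_dotProduct, huw, star_zero]
  have hls : (s : ℂ) * (lam / (s : ℂ) ^ 2) = lam / s := by field_simp
  have hentry : ∀ (M : Matrix m m ℂ) (x y : m → ℂ) (c : ℂ), M *ᵥ star x = c • y →
      ∀ i, ∑ j, M i j * star (x j) = y i * c := fun M x y c h i => by
    rw [mul_comm]
    exact congrFun h i
  -- The order `w`, `u` puts the coefficient `s` of `A ū = s w` in the upper right corner.
  refine ⟨of fun i j => (![w i, u i] : Fin 2 → ℂ) j, ?_, ?_, ?_⟩ <;> ext i j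
  · fin_cases i <;> fin_cases j
    · exact hw
    · exact hwu
    · exact huw
    · exact hu
  · fin_cases j
    · simpa [mul_apply, hls] using hentry _ _ _ _ h2 i
    · simpa [mul_apply] using hentry _ _ _ _ h1 i
  · fin_cases j
    · simpa [mul_apply] using hentry _ _ _ _ h4 i
    · simpa [mul_apply, hls] using hentry _ _ _ _ h3 i

variable [DecidableEq m]

open scoped Matrix.Norms.L2Operator in
-- Fuglede–Putnam for `A (Ā A) = (A Ā) A`; the operator norm supplies the C⋆-algebra structure it
-- uses.
theorem mul_star_comm_of_normal {A : Matrix m m ℂ} (h : IsStarNormal (A * A.map star)) :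
    A * star (A.map star * A) = star (A * A.map star) * A := by
  have h1 : IsStarNormal (A.map star * A) := by
    refine ⟨?_⟩
    have h2 := congrArg (fun M : Matrix m m ℂ => M.map star) h.star_comm_self.eq
    have h3 : (A.map star).map star = A := by ext; simp
    simp only [map_star_mul] at h2
    rw [h3] at h2
    have h4 : (star (A * A.map star)).map star = star (A.map star * A) := by
      change star ((A * A.map star).map star) = _
      rw [map_star_mul, h3]
    rw [h4] at h2
    exact h2
  have h5 : SemiconjBy A (A.map star * A) (A * A.map star) := by
    simp only [SemiconjBy, Matrix.mul_assoc]
  exact (SemiconjBy.star_right h1 h h5).eq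

open scoped ComplexOrder in
theorem exists_common_eigenvector {H N : Matrix m m ℂ} (hH : H.PosSemidef) (h0 : H ≠ 0)
    (h : Commute N H) : ∃ (s : ℝ) (lam : ℂ) (u : m → ℂ), 0 < s ∧ star u ⬝ᵥ u = 1 ∧
      H *ᵥ u = ((s : ℂ) ^ 2) • u ∧ N *ᵥ u = lam • u := by
  obtain ⟨i, hi⟩ : ∃ i, hH.isHermitian.eigenvalues i ≠ 0 := by
    by_contra! hc
    exact h0 (hH.isHermitian.eigenvalues_eq_zero_iff.1 (funext hc))
  set r := hH.isHermitian.eigenvalues i with hr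
  have hr0 : 0 < r := lt_of_le_of_ne (hH.eigenvalues_nonneg i) hi.symm
  let E := Module.End.eigenspace (toLin' H) (r : ℂ)
  have hv := hH.isHermitian.mulVec_eigenvectorBasis i
  have hE : ∃ v ∈ E, v ≠ 0 := by
    refine ⟨(hH.isHermitian.eigenvectorBasis i : m → ℂ), ?_, ?_⟩
    · rw [Module.End.mem_eigenspace_iff, toLin'_apply, hv]; rfl
    · intro h
      have := hH.isHermitian.eigenvectorBasis.orthonormal.ne_zero i
      exact this (by ext j; exact congrFun h j)
  -- `N` commutes with `H`, so it preserves the eigenspace `E` and has an eigenvector there.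
  have hmap : ∀ x ∈ E, toLin' N x ∈ E := by
    intro x hx
    rw [Module.End.mem_eigenspace_iff, toLin'_apply] at hx ⊢
    rw [toLin'_apply, mulVec_mulVec, ← h.eq, ← mulVec_mulVec, hx, mulVec_smul]
  obtain ⟨v, hvE, hv0⟩ := hE
  have : Nontrivial E := ⟨⟨⟨v, hvE⟩, 0, fun h => hv0 (congrArg Subtype.val h)⟩⟩
  obtain ⟨lam, hlam⟩ := Module.End.exists_eigenvalue ((toLin' N).restrict hmap)
  obtain ⟨⟨x, hx⟩, hx1⟩ := hlam.exists_hasEigenvector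
  have hx0 : x ≠ 0 := fun h => hx1.2 (Subtype.ext h)
  have hx2 : N *ᵥ x = lam • x := congrArg Subtype.val hx1.apply_eq_smul
  have hx3 : H *ᵥ x = (r : ℂ) • x := by
    rwa [Module.End.mem_eigenspace_iff, toLin'_apply] at hx
  obtain ⟨c, hc⟩ := exists_normalize hx0
  refine ⟨Real.sqrt r, lam, (c : ℂ) • x, Real.sqrt_pos.2 hr0, hc, ?_, ?_⟩
  · rw [mulVec_smul, hx3, smul_comm, ← Complex.ofReal_pow, Real.sq_sqrt hr0.le]
  · rw [mulVec_smul, hx2, smul_comm]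

open scoped ComplexOrder in
-- `M = N - λ` is normal, so `Mᴴ u` and `M u` have the same length, namely zero.
theorem star_mulVec_of_normal {N : Matrix m m ℂ} (h : IsStarNormal N) {lam : ℂ} {u : m → ℂ}
    (hu : N *ᵥ u = lam • u) : Nᴴ *ᵥ u = star lam • u := by
  set M := N - lam • (1 : Matrix m m ℂ) with hM
  have hMH : Mᴴ = Nᴴ - star lam • (1 : Matrix m m ℂ) := by
    rw [hM, conjTranspose_sub, conjTranspose_smul, conjTranspose_one]
  have h1 : M *ᵥ u = 0 := by rw [hM, sub_mulVec, smul_mulVec, one_mulVec, hu, sub_self]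
  have h2 : Mᴴ * M = M * Mᴴ := by
    have h3 : Nᴴ * N = N * Nᴴ := h.star_comm_self.eq
    rw [hMH, hM, sub_mul, mul_sub, mul_sub, sub_mul, mul_sub, mul_sub, h3]
    simp only [smul_mul_assoc, mul_smul_comm, Matrix.one_mul, Matrix.mul_one, smul_smul,
      mul_comm lam]
    abel
  have h4 : star (Mᴴ *ᵥ u) ⬝ᵥ (Mᴴ *ᵥ u) = 0 := by
    rw [star_mulVec, conjTranspose_conjTranspose, ← dotProduct_mulVec, mulVec_mulVec, ← h2,
      ← mulVec_mulVec, h1, mulVec_zero, dotProduct_zero]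
  have h5 := dotProduct_star_self_eq_zero.1 (by rwa [dotProduct_comm] at h4)
  rwa [hMH, sub_mulVec, smul_mulVec, one_mulVec, sub_eq_zero] at h5

open scoped ComplexOrder in
theorem exists_reducing_pair {A : Matrix m m ℂ} (hA : IsStarNormal (A * A.map star))
    (h0 : A ≠ 0) : ∃ (s : ℝ) (lam : ℂ) (u w : m → ℂ), 0 < s ∧ star u ⬝ᵥ u = 1 ∧
      star w ⬝ᵥ w = 1 ∧ A *ᵥ star u = (s : ℂ) • w ∧ A *ᵥ star w = (lam / s) • u ∧
      Aᵀ *ᵥ star u = (lam / s) • w ∧ Aᵀ *ᵥ star w = (s : ℂ) • u := by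
  have e1 : (A.map star)ᴴ = Aᵀ := by ext; simp
  have F : A * (Aᴴ * Aᵀ) = Aᵀ * Aᴴ * A := by
    have := mul_star_comm_of_normal hA
    rwa [star_eq_conjTranspose, star_eq_conjTranspose, conjTranspose_mul, conjTranspose_mul,
      e1] at this
  have G : A * A.map star * Aᵀ = Aᵀ * A.map star * A := by
    have := congrArg Matrix.transpose F
    simp only [transpose_mul, transpose_transpose, conjTranspose_transpose] at this
    rw [this, Matrix.mul_assoc]
  have hH : (Aᵀ * A.map star).PosSemidef := by
    rw [← e1]; exact posSemidef_conjTranspose_mul_self _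
  have hH0 : Aᵀ * A.map star ≠ 0 := by
    rw [← e1, Ne, conjTranspose_mul_self_eq_zero]
    intro h
    apply h0
    ext i j
    simpa using congrFun (congrFun h i) j
  have hcomm : Commute (A * A.map star) (Aᵀ * A.map star) := by
    rw [commute_iff_eq, ← Matrix.mul_assoc, G, Matrix.mul_assoc (Aᵀ * A.map star)]
  obtain ⟨s, lam, u, hs, hu, hHu, hNu⟩ := exists_common_eigenvector hH hH0 hcomm
  have hs' : (s : ℂ) ≠ 0 := by simpa using hs.ne'
  have hbar : ∀ (M : Matrix m m ℂ) (v : m → ℂ), star (M *ᵥ v) = M.map star *ᵥ star v := by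
    intro M v
    ext i
    simp [mulVec, dotProduct]
  have hN' := congrArg star (star_mulVec_of_normal hA hNu)
  have hH' := congrArg star hHu
  have hAA : (A.map star).map star = A := by ext; simp
  have hAH : Aᵀ.map star = Aᴴ := rfl
  have hAH' : Aᴴ.map star = Aᵀ := by ext; simp
  rw [hbar, conjTranspose_mul, e1, map_star_mul, hAH, hAH', star_smul, star_star] at hN'
  rw [hbar, map_star_mul, hAA, hAH, star_smul] at hH'
  have hss : star ((s : ℂ) ^ 2) = (s : ℂ) ^ 2 := by simp
  rw [hss] at hH'
  -- Conjugating the eigenvector equations gives `Aᴴ A ū = s² ū` and `Aᴴ Aᵀ ū = λ ū`; `F` links the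
  -- two.
  have key : (s : ℂ) ^ 2 • (Aᵀ *ᵥ star u) = lam • (A *ᵥ star u) := by
    rw [← mulVec_smul, ← hH', mulVec_mulVec, ← Matrix.mul_assoc, ← F, ← mulVec_mulVec, hN',
      mulVec_smul]
  have hw : star ((s : ℂ)⁻¹ • (A *ᵥ star u)) = (s : ℂ)⁻¹ • (A.map star *ᵥ u) := by
    rw [star_smul, hbar, star_star]; simp
  refine ⟨s, lam, u, (s : ℂ)⁻¹ • (A *ᵥ star u), hs, hu, ?_, ?_, ?_, ?_, ?_⟩
  -- The squared length of `w` equals that of `w̄ = s⁻¹ Ā u`, which is `s⁻² uᴴ H u = 1`.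
  · rw [dotProduct_comm]
    nth_rewrite 1 [← star_star ((s : ℂ)⁻¹ • (A *ᵥ star u))]
    rw [hw, star_smul, smul_dotProduct, dotProduct_smul, star_mulVec, e1, ← dotProduct_mulVec,
      mulVec_mulVec, hHu, dotProduct_smul, hu]
    simp only [star_inv₀, Complex.star_def, Complex.conj_ofReal, smul_eq_mul]
    field_simp
  · rw [smul_smul, mul_inv_cancel₀ hs', one_smul]
  · rw [hw, mulVec_smul, mulVec_mulVec, hNu, smul_smul, mul_comm, div_eq_mul_inv]
  · have h1 : Aᵀ *ᵥ star u = ((s : ℂ) ^ 2)⁻¹ • (lam • (A *ᵥ star u)) := by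
      rw [← key, smul_smul, inv_mul_cancel₀ (pow_ne_zero 2 hs'), one_smul]
    rw [h1, smul_smul, smul_smul]
    congr 1
    field_simp
  · rw [hw, mulVec_smul, mulVec_mulVec, hHu, smul_smul]
    congr 1
    field_simp

theorem exists_reducing_block {A : Matrix m m ℂ} (hm : Nonempty m)
    (hA : IsStarNormal (A * A.map star)) :
    ∃ (c : CongruenceBlock) (V : Matrix m (Fin c.size) ℂ), c.IsCanonical ∧ Vᴴ * V = 1 ∧
      A * V.map star = V * c.toMatrix ∧ Aᵀ * V.map star = V * c.toMatrixᵀ := by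
  by_cases h0 : A = 0
  · obtain ⟨i⟩ := hm
    subst h0
    exact exists_one_of_vec (σ := 0) le_rfl (v := Pi.single i 1) (by simp)
      (by rw [zero_mulVec]; simp) (by rw [transpose_zero, zero_mulVec]; simp)
  obtain ⟨s, lam, u, w, hs, hu, hw, h1, h2, h3, h4⟩ := exists_reducing_pair hA h0
  have hs' : (s : ℂ) ≠ 0 := by simpa using hs.ne'
  by_cases hlam : lam = (s : ℂ) ^ 2
  · have hls : lam / s = s := by rw [hlam]; field_simp
    rw [hls] at h2 h3
    -- Here `x ↦ A x̄` and `x ↦ Aᵀ x̄` both exchange `u` and `w` up to the factor `s`, so `u + w` is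
    -- multiplied by `s`. If it vanishes, `i u` serves instead, as antilinearity turns the factor
    -- `-s` into `s`.
    by_cases hx : u + w = 0
    · obtain rfl : w = -u := (neg_eq_of_add_eq_zero_right hx).symm
      refine exists_one_of_vec hs.le (v := Complex.I • u) ?_ ?_ ?_
      · simp [star_smul, hu]
      · rw [star_smul, mulVec_smul, h1]
        ext i; simp; ring
      · rw [star_smul, mulVec_smul, h3]
        ext i; simp; ring
    · obtain ⟨c, hc⟩ := exists_normalize hx
      refine exists_one_of_vec hs.le hc ?_ ?_
      · rw [star_smul, star_add, mulVec_smul, mulVec_add, h1, h2, ← smul_add, add_comm w,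
          smul_comm]
        simp
      · rw [star_smul, star_add, mulVec_smul, mulVec_add, h3, h4, ← smul_add, add_comm w,
          smul_comm]
        simp
  · refine exists_two_of_vec hs hlam hu hw ?_ h1 h2 h3 h4
    -- The scalar `uᴴ A ū` equals its own transpose; so `s (uᴴ w) = (λ / s) (uᴴ w)`, and `λ ≠ s²`
    -- forces `uᴴ w = 0`.
    have h5 : star u ⬝ᵥ A *ᵥ star u = star u ⬝ᵥ Aᵀ *ᵥ star u := by
      rw [mulVec_transpose, dotProduct_mulVec, dotProduct_comm]
    rw [h1, h3, dotProduct_smul, dotProduct_smul, smul_eq_mul, smul_eq_mul] at h5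
    by_contra hne
    have h6 := mul_right_cancel₀ hne h5
    apply hlam
    field_simp at h6
    exact h6.symm

end

/-! ### Splitting off a block and induction -/

/-- An isometry extends to a unitary matrix. -/
theorem exists_unitary_extension {m p : Type*} [Fintype m] [DecidableEq m] [Fintype p]
    [DecidableEq p] {V : Matrix m p ℂ} (hV : Vᴴ * V = 1) :
    ∃ (r : ℕ) (W : Matrix m (Fin r) ℂ), Wᴴ * W = 1 ∧ Vᴴ * W = 0 ∧ V * Vᴴ + W * Wᴴ = 1 := by
  have hcard : Fintype.card p ≤ Fintype.card m := by
    have h1 : (Vᴴ * V).rank = Fintype.card p := by rw [hV, rank_one]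
    rw [← h1]
    exact (rank_mul_le_right _ _).trans V.rank_le_card_height
  let v : p ⊕ Fin (Fintype.card m - Fintype.card p) → EuclideanSpace ℂ m :=
    Sum.elim (fun j => WithLp.toLp 2 fun i => V i j) (fun _ => 0)
  have hv : Orthonormal ℂ
      ((Set.range (Sum.inl : p → p ⊕ Fin (Fintype.card m - Fintype.card p))).domRestrict v) := by
    rw [orthonormal_iff_ite]
    rintro ⟨i, hi⟩ ⟨i', hi'⟩
    obtain ⟨j, rfl⟩ := id hi
    obtain ⟨j', rfl⟩ := id hi'
    have := congrFun (congrFun hV j) j'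
    rw [one_apply] at this
    simp only [Subtype.mk.injEq, Sum.inl.injEq]
    simpa [v, EuclideanSpace.inner_eq_star_dotProduct, mul_apply, dotProduct, mul_comm] using this
  obtain ⟨b, hb⟩ := hv.exists_orthonormalBasis_extension_of_card_eq (by simp; omega)
  let Q : Matrix m (p ⊕ Fin (Fintype.card m - Fintype.card p)) ℂ := of fun i j => b j i
  have hQ : Qᴴ * Q = 1 := by
    ext j j'
    have := orthonormal_iff_ite.1 b.orthonormal j j'
    rw [one_apply]
    simpa [Q, EuclideanSpace.inner_eq_star_dotProduct, mul_apply, dotProduct, mul_comm] using this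
  have hQ' : Q * Qᴴ = 1 := by
    refine (mul_eq_one_comm_of_card_eq _ _ _ ?_).1 hQ
    rw [Fintype.card_sum, Fintype.card_fin]
    omega
  have hQV : Q = fromCols V Q.toCols₂ := by
    ext i (j | j)
    · simp [Q, hb _ (Set.mem_range_self j), v]
    · rfl
  rw [hQV, conjTranspose_fromCols_eq_fromRows_conjTranspose] at hQ hQ'
  rw [fromRows_mul_fromCols, ← fromBlocks_one, fromBlocks_inj] at hQ
  rw [fromCols_mul_fromRows] at hQ'
  exact ⟨_, Q.toCols₂, hQ.2.2.2, hQ.2.1, hQ'⟩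

/-- In the unitary basis `[V W]`, `h1` kills the lower left block `Wᴴ A V̄ = Wᴴ V C`, and `h2`,
transposed to `Vᴴ A = C Vᵀ`, kills the upper right one. -/
theorem exists_split {m : Type*} [Fintype m] [DecidableEq m] {p : Type*} [Fintype p]
    [DecidableEq p] {A : Matrix m m ℂ} {V : Matrix m p ℂ} {C : Matrix p p ℂ} (hV : Vᴴ * V = 1)
    (h1 : A * V.map star = V * C) (h2 : Aᵀ * V.map star = V * Cᵀ) :
    ∃ (r : ℕ) (B : Matrix (Fin r) (Fin r) ℂ), UCong A (fromBlocks C 0 0 B) := by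
  obtain ⟨r, W, hW, hVW, hsum⟩ := exists_unitary_extension hV
  have hWV : Wᴴ * V = 0 := by
    have := congrArg conjTranspose hVW
    rwa [conjTranspose_mul, conjTranspose_conjTranspose, conjTranspose_zero] at this
  have h3 : Vᴴ * A = C * Vᵀ := by
    have := congrArg transpose h2
    rwa [transpose_mul, transpose_mul, transpose_transpose, transpose_transpose] at this
  refine ⟨r, Wᴴ * A * W.map star, UCong.symm ⟨(fromCols V W)ᴴ, ?_, ?_, ?_⟩⟩
  · rw [conjTranspose_conjTranspose, conjTranspose_fromCols_eq_fromRows_conjTranspose,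
      fromRows_mul_fromCols, hV, hW, hVW, hWV, fromBlocks_one]
  · rw [conjTranspose_conjTranspose, conjTranspose_fromCols_eq_fromRows_conjTranspose,
      fromCols_mul_fromRows, hsum]
  · have e : (fromCols V W)ᴴᵀ = fromCols (V.map star) (W.map star) := by
      ext i j; cases j <;> simp
    rw [e, conjTranspose_fromCols_eq_fromRows_conjTranspose, fromRows_mul, fromRows_mul_fromCols,
      Matrix.mul_assoc Vᴴ, Matrix.mul_assoc Wᴴ A (V.map star), h1, ← Matrix.mul_assoc,
      ← Matrix.mul_assoc, hV, hWV,
      Matrix.one_mul, Matrix.zero_mul, h3]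
    have e2 : Vᵀ * W.map star = 0 := by
      have := congrArg transpose hWV
      rwa [transpose_mul, transpose_zero, conjTranspose_transpose] at this
    rw [Matrix.mul_assoc C, e2, Matrix.mul_zero]

theorem uCong_option {ι : Type} [Fintype ι] [DecidableEq ι] (c : CongruenceBlock)
    (b : ι → CongruenceBlock) :
    UCong (fromBlocks c.toMatrix 0 0 (blockDiagonal' fun i => (b i).toMatrix))
      (blockDiagonal' fun i : Option ι => (i.elim c b).toMatrix) := by
  let e : (Σ i : Option ι, Fin (i.elim c b).size) ≃ Fin c.size ⊕ Σ i, Fin (b i).size :=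
    { toFun := fun x => match x with
        | ⟨none, j⟩ => Sum.inl j
        | ⟨some i, j⟩ => Sum.inr ⟨i, j⟩
      invFun := Sum.elim (fun j => ⟨none, j⟩) (fun x => ⟨some x.1, x.2⟩)
      left_inv := by rintro ⟨_ | i, j⟩ <;> rfl
      right_inv := by rintro (j | ⟨i, j⟩) <;> rfl }
  have h : (blockDiagonal' fun i : Option ι => (i.elim c b).toMatrix) =
      (fromBlocks c.toMatrix 0 0 (blockDiagonal' fun i => (b i).toMatrix)).submatrix e e := by
    ext ⟨_ | i, x⟩ ⟨_ | j, y⟩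
    · exact blockDiagonal'_apply_eq _ _ _ _
    · exact blockDiagonal'_apply_ne _ _ _ (by simp)
    · exact blockDiagonal'_apply_ne _ _ _ (by simp)
    · by_cases hij : i = j
      · subst hij
        have h2 : blockDiagonal' (fun i => (b i).toMatrix) ⟨i, x⟩ ⟨i, y⟩ = (b i).toMatrix x y :=
          blockDiagonal'_apply_eq _ _ _ _
        exact (blockDiagonal'_apply_eq _ _ _ _).trans h2.symm
      · have h2 : blockDiagonal' (fun i => (b i).toMatrix) ⟨i, x⟩ ⟨j, y⟩ = 0 :=
          blockDiagonal'_apply_ne _ _ _ hij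
        exact (blockDiagonal'_apply_ne _ _ _ (by simpa using hij)).trans h2.symm
  rw [h]
  exact UCong.submatrix _ e

/-- Arbitrary index types let the induction adjoin a block by passing from `ι` to `Option ι`. -/
theorem exists_uCong_blockDiagonal (N : ℕ) : ∀ {m : Type} [Fintype m] [DecidableEq m]
    (A : Matrix m m ℂ), Fintype.card m = N → IsStarNormal (A * A.map star) →
    ∃ (ι : Type) (_ : Fintype ι) (_ : DecidableEq ι) (b : ι → CongruenceBlock),
      (∀ i, (b i).IsCanonical) ∧ UCong A (blockDiagonal' fun i => (b i).toMatrix) := by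
  induction N using Nat.strong_induction_on with
  | _ N ih =>
  intro m _ _ A hN hA
  rcases isEmpty_or_nonempty m with hm | hm
  · refine ⟨Empty, inferInstance, inferInstance, Empty.elim, fun i => i.elim, 0, ?_, ?_, ?_⟩
    · ext i; exact hm.elim i
    · ext i; exact i.1.elim
    · ext i; exact hm.elim i
  · obtain ⟨c, V, hc, hV, h1, h2⟩ := exists_reducing_block hm hA
    obtain ⟨r, B, hB⟩ := exists_split hV h1 h2
    have hcard := hB.card_eq
    -- Normality of a block diagonal matrix passes to its diagonal blocks.
    have hnB : IsStarNormal (B * B.map star) := by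
      have h3 := hB.isStarNormal hA
      have e : (fromBlocks c.toMatrix 0 0 B).map star =
          fromBlocks (c.toMatrix.map star) 0 0 (B.map star) := by
        rw [fromBlocks_map]; simp
      have h4 := h3.star_comm_self.eq
      rw [e, fromBlocks_multiply, star_eq_conjTranspose, fromBlocks_conjTranspose,
        fromBlocks_multiply, fromBlocks_multiply, fromBlocks_inj] at h4
      refine ⟨?_⟩
      rw [commute_iff_eq, star_eq_conjTranspose]
      simpa using h4.2.2.2
    have hr : r < N := by
      have := c.size_pos
      rw [Fintype.card_sum, Fintype.card_fin, Fintype.card_fin] at hcard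
      omega
    obtain ⟨ι, _, _, b, hb, hBb⟩ := ih r hr B (Fintype.card_fin r) hnB
    refine ⟨Option ι, inferInstance, inferInstance, fun i => i.elim c b, ?_,
      hB.trans (((UCong.refl _).fromBlocks hBb).trans (uCong_option c b))⟩
    rintro (_ | i)
    exacts [hc, hb i]

theorem exists_uCong_directSum {n : ℕ} {A : Matrix (Fin n) (Fin n) ℂ}
    (hA : IsStarNormal (A * A.map star)) :
    ∃ (k : ℕ) (b : Fin k → CongruenceBlock) (h : ∑ i, (b i).size = n),
      (∀ i, (b i).IsCanonical) ∧ UCong A (CongruenceBlock.directSum b h) := by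
  obtain ⟨ι, _, _, b, hb, hAb⟩ := exists_uCong_blockDiagonal n A (Fintype.card_fin n) hA
  let e := (Fintype.equivFin ι).symm
  have h1 : UCong A (blockDiagonal' fun i => (b (e i)).toMatrix) :=
    hAb.trans (UCong.blockDiagonal e fun i => UCong.refl _).symm
  have h2 : ∑ i, (b (e i)).size = n := by
    have := h1.card_eq
    simpa using this.symm
  exact ⟨_, fun i => b (e i), h2, fun i => hb _, h1.trans (uCong_directSum _ h2).symm⟩

theorem mainTheorem1 (n : ℕ) (A : Matrix (Fin n) (Fin n) ℂ) :
    -- existence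
    (CongruenceNormal A →
      ∃ (k : ℕ) (b : Fin k → CongruenceBlock) (h : ∑ i, (b i).size = n),
        (∀ i, (b i).IsCanonical) ∧ UnitarilyCongruent A (CongruenceBlock.directSum b h)) ∧
    -- uniqueness: the direct sums obtained from a given one by permuting blocks and by replacing
    -- parameters `μ` by `μ⁻¹` are exactly the direct sums to which `A` is unitarily congruent
    (∀ (k : ℕ) (b : Fin k → CongruenceBlock) (h : ∑ i, (b i).size = n)
        (k' : ℕ) (b' : Fin k' → CongruenceBlock) (h' : ∑ i, (b' i).size = n),
        (∀ i, (b i).IsCanonical) → (∀ i, (b' i).IsCanonical) →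
        UnitarilyCongruent A (CongruenceBlock.directSum b h) →
        (UnitarilyCongruent A (CongruenceBlock.directSum b' h') ↔
          ∃ e : Fin k ≃ Fin k', ∀ i, CongruenceBlock.Equivalent (b i) (b' (e i)))) ∧
    -- converse
    ((∃ (k : ℕ) (b : Fin k → CongruenceBlock) (h : ∑ i, (b i).size = n),
        (∀ i, (b i).IsCanonical) ∧ UnitarilyCongruent A (CongruenceBlock.directSum b h)) →
      CongruenceNormal A) := by
  simp only [congruenceNormal_iff, unitarilyCongruent_iff]
  refine ⟨exists_uCong_directSum, ?_, ?_⟩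
  · intro k b h k' b' h' hb hb' hA
    constructor
    · intro hA'
      exact exists_equiv_equivalent hb hb'
        ((uCong_directSum b h).symm.trans (hA.symm.trans (hA'.trans (uCong_directSum b' h'))))
    · rintro ⟨e, he⟩
      exact hA.trans ((uCong_directSum b h).trans
        ((UCong.blockDiagonal e fun i => (he i).uCong).trans (uCong_directSum b' h').symm))
  · rintro ⟨k, b, h, -, hA⟩
    exact (hA.trans (uCong_directSum b h)).symm.isStarNormal
      (isStarNormal_blockDiagonal_toMatrix b)
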